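/- A hard-attention transformer with $L$ layers and $H$ heads per layer over an alphabet $\mathcal V$ is given by a symbol embedding $v:\mathcal V\to E$, positional embeddings $p_1,p_2,\dots\in P$, and maps $f$, $f^{att}_{k,h}$, $f^{act}_k$ ($1\le k\le L$, $1\le h\le H$) and $g$, all of them arbitrary and independent of the input length. The activations of each layer range over an arbitrary set (not necessarily consisting of vectors), and attention scores are real numbers. On a word $w_1\dots w_N$ with $N\ge 1$ it computes $y_i^{(0)}=f(v(w_i),p_i)$ and, for $k=1,\dots,L$ and $i=1,\dots,N$, $$y_i^{(k)}=f^{act}_k\bigl(y_i^{(k-1)},\,y_{j(i,k,1)}^{(k-1)},\dots,y_{j(i,k,H)}^{(k-1)}\bigr),$$ where $j(i,k,h)$ is the first position $j\in\{1,\dots,N\}$ that maximizes $f^{att}_{k,h}(y_i^{(k-1)},y_j^{(k-1)})$. Its output is $g(y_N^{(L)})$. An input consists of bits $x_1\dots x_n\in\{0,1\}^n$, encoded by two symbols of $\mathcal V$ and followed by a fixed end-of-sequence symbol of $\mathcal V$ (so $N=n+1$). An input restriction $\rho$ is a family of maps $\rho_n:\{1,\dots,n\}\to\{*,0,1\}$,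 $n\in\mathbb N$. Applying $\rho$ to an input means replacing $x_i$ by $\rho_n(i)$ whenever $\rho_n(i)\in\{0,1\}$. Theorem 1. Let a hard-attention transformer and $C\in(0,1)$ be given. Then there are an input restriction $\rho$ and an integer $c>0$ such that $$|\{i\le n:\rho_n(i)=*\}|\ge Cn\quad\text{for all sufficiently large } n,$$ and such that for every $n$ the output of the transformer on the restricted input, as a function of $(x_1,\dots,x_n)\in\{0,1\}^n$, depends on at most $c$ of the bits: there is a set $S_n\subseteq\{1,\dots,n\}$ with $|S_n|\le c$ such that any two inputs that agree on $S_n$ have the same output after $\rho_n$ is applied. The integer $c$ does not depend on $n$. -/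

import Mathlib

open Filter

/-- Every finite nonempty family of reals has a position at which its maximum is attained. -/
theorem argmaxSet_nonempty {n : ℕ} (a : Fin (n + 1) → ℝ) :
    (Set.toFinite {i : Fin (n + 1) | ∀ j, a j ≤ a i}).toFinset.Nonempty := by
  obtain ⟨i, hi⟩ := Finite.exists_max a
  exact ⟨i, by simpa using hi⟩

/-- `argmax_j a_j`, where among several maximal positions the first one is chosen. -/
noncomputable def firstArgmax {n : ℕ} (a : Fin (n + 1) → ℝ) : Fin (n + 1) :=
  (Set.toFinite {i : Fin (n + 1) | ∀ j, a j ≤ a i}).toFinset.min' (argmaxSet_nonempty a)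

/-- The parameters of a hard-attention transformer with `L` layers and `H` heads in each layer,
over the alphabet `V`.  Symbol embeddings live in `E`, positional embeddings in `P`, the layer-`k`
activations in `Y k` and the outputs in `O`; these are arbitrary types (vectors or anything else),
and all maps are arbitrary.  No parameter depends on the input length.
Layer `k + 1` is computed by `att k` and `act k`; only those with `k < L` and the types `Y k` with
`k ≤ L` matter (beyond that one may take one-point types). -/
structure HardTransformer (V : Type*) (E : Type*) (P : Type*) (Y : ℕ → Type*) (O : Type*)
    (L H : ℕ) where
  /-- embedding of the input symbols -/
  emb : V → E
  /-- positional embeddings -/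
  pos : ℕ → P
  /-- the map that combines the two into a layer-0 activation -/
  combine : E → P → Y 0
  /-- the attention score of each head -/
  att : (k : ℕ) → Fin H → Y k → Y k → ℝ
  /-- the map that computes the new activation from the old one (skip connection) and from the
  activations of the heads -/
  act : (k : ℕ) → Y k → (Fin H → Y k) → Y (k + 1)
  /-- the map that computes the output from the last activation of the top layer -/
  readout : Y L → O

namespace HardTransformer

variable {V : Type*} {E : Type*} {P : Type*} {Y : ℕ → Type*} {O : Type*} {L H : ℕ}

/-- The activation of a head at the position whose attention scores are `a`: as the hard attention
weights are `1` at the argmax and `0` elsewhere, the weighted sum of the activations `y j` is the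
activation at the argmax. -/
noncomputable def headActivation {n : ℕ} {A : Type*} (a : Fin (n + 1) → ℝ)
    (y : Fin (n + 1) → A) : A :=
  y (firstArgmax a)

/-- The activations of layer `k` at all positions, on a nonempty input word `w`. -/
noncomputable def activation (T : HardTransformer V E P Y O L H) {n : ℕ} (w : Fin (n + 1) → V) :
    (k : ℕ) → Fin (n + 1) → Y k
  | 0 => fun i => T.combine (T.emb (w i)) (T.pos i)
  | k + 1 => fun i =>
      T.act k (T.activation w k i) fun h =>
        headActivation (fun j => T.att k h (T.activation w k i) (T.activation w k j))
          (T.activation w k)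

/-- The output, computed from the layer-`L` activation at the last position of the word. -/
noncomputable def output (T : HardTransformer V E P Y O L H) {n : ℕ} (w : Fin (n + 1) → V) : O :=
  T.readout (T.activation w L (Fin.last n))

end HardTransformer

/-- An input restriction: for each `n` a map from the `n` positions to `{*, 0, 1}`, where `*` is
`none` and the bits `0`, `1` are `some false`, `some true`. -/
abbrev InputRestriction : Type := (n : ℕ) → Fin n → Option Bool

namespace InputRestriction

/-- The positions `i` with `ρ_n(i) = *`. -/
def free (ρ : InputRestriction) (n : ℕ) : Finset (Fin n) :=
  Finset.univ.filter fun i => ρ n i = none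

/-- Apply a restriction: `x i` is replaced by the bit `ρ_n(i)` unless `ρ_n(i) = *`. -/
def apply (ρ : InputRestriction) {n : ℕ} (x : Fin n → Bool) : Fin n → Bool :=
  fun i => (ρ n i).getD (x i)

end InputRestriction

/-- The input word of a bit string: the symbols that encode the bits, followed by the
end-of-sequence symbol. -/
def inputWord {V : Type*} (bit : Bool → V) (eos : V) {n : ℕ} (x : Fin n → Bool) :
    Fin (n + 1) → V :=
  Fin.snoc (α := fun _ => V) (fun i => bit (x i)) eos

/-! By induction on the layer, after fixing a small fraction of the bits every activation depends on
boundedly many bits. Suppose the activation at each `j` depends only on at most `c` bits `D j`. A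
query is a position, a setting of its bits and a head; there are O(n) of them.

For one query, rank the positions by the largest score they can attain. Fixing the bits of any one
of the top `K` positions so that it attains its maximum confines the attention to these `K`
(`exists_narrowing_nodes`). So `K` of the O(n) moves "fix `D j` to given values" narrow this query,
and by double counting some move narrows a K/O(n) share of all wide queries
(`exists_narrowing_step`). Greedy repetition narrows all queries and fixes only a small fraction of
the bits (`exists_narrow_subcube`). A head then chooses among `K` candidates of `c` bits each, so
the next layer is local again (`exists_subcube_local_layer`). -/

/-! ### Subcubes of the Boolean cube. -/

/-- The inputs that take prescribed values on a finite set of fixed positions. -/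
structure Subcube (n : ℕ) where
  /-- the fixed positions -/
  fixed : Finset (Fin n)
  /-- the values there -/
  val : Fin n → Bool

namespace Subcube

variable {n : ℕ}

/-- The inputs in a subcube. -/
def points (Q : Subcube n) : Set (Fin n → Bool) :=
  {x | ∀ i ∈ Q.fixed, x i = Q.val i}

theorem val_mem_points (Q : Subcube n) : Q.val ∈ Q.points := fun _ _ => rfl

/-- The values `a`, overwritten on `D` by the indicator function of `A`. -/
def patch (D A : Finset (Fin n)) (a : Fin n → Bool) : Fin n → Bool :=
  fun i => if i ∈ D then decide (i ∈ A) else a i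

/-- Fix the positions in `D` to the indicator function of `A`. -/
def fix (Q : Subcube n) (D A : Finset (Fin n)) : Subcube n :=
  ⟨Q.fixed ∪ D, patch D A Q.val⟩

theorem patch_filter_of_mem {D : Finset (Fin n)} {i : Fin n} (hi : i ∈ D) (x a : Fin n → Bool) :
    patch D (D.filter fun i => x i = true) a i = x i := by
  simp [patch, hi]

theorem patch_filter_mem_points (Q : Subcube n) (D : Finset (Fin n)) {x : Fin n → Bool}
    (hx : x ∈ Q.points) : patch D (D.filter fun i => x i = true) Q.val ∈ Q.points := by
  intro i hi
  by_cases hD : i ∈ D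
  · rw [patch_filter_of_mem hD, hx i hi]
  · simp [patch, hD]

/-- `fix` may overwrite values fixed by `Q`; reading the new values off a point of `Q` rules out a
conflict. -/
theorem fix_points_subset (Q : Subcube n) (D : Finset (Fin n)) {x : Fin n → Bool}
    (hx : x ∈ Q.points) : (Q.fix D (D.filter fun i => x i = true)).points ⊆ Q.points := by
  intro y hy i hi
  rw [hy i (Finset.mem_union_left _ hi)]
  exact Q.patch_filter_mem_points D hx i hi

theorem card_fix_le (Q : Subcube n) (D A : Finset (Fin n)) :
    (Q.fix D A).fixed.card ≤ Q.fixed.card + D.card :=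
  Finset.card_union_le _ _

/-- The input restriction of a subcube at length `n`. -/
def restriction (Q : Subcube n) : Fin n → Option Bool :=
  fun i => if i ∈ Q.fixed then some (Q.val i) else none

end Subcube

/-! ### Locality and first maximizers. -/

/-- On the inputs in `Q`, the function `f` depends only on the bits in `D`. -/
def LocalOn {n : ℕ} {α : Type*} (Q : Set (Fin n → Bool)) (D : Finset (Fin n))
    (f : (Fin n → Bool) → α) : Prop :=
  ∀ x ∈ Q, ∀ y ∈ Q, (∀ i ∈ D, x i = y i) → f x = f y

/-- On the inputs in `Q`, the first maximizer of the scores `s` takes at most `K` values. -/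
def NarrowOn {n m : ℕ} (Q : Set (Fin n → Bool)) (K : ℕ)
    (s : Fin (m + 1) → (Fin n → Bool) → ℝ) : Prop :=
  ∃ J : Finset (Fin (m + 1)), J.card ≤ K ∧ ∀ x ∈ Q, firstArgmax (fun j => s j x) ∈ J

theorem LocalOn.mono {n : ℕ} {α : Type*} {Q Q' : Set (Fin n → Bool)} {D D' : Finset (Fin n)}
    {f : (Fin n → Bool) → α} (h : LocalOn Q D f) (hQ : Q' ⊆ Q) (hD : D ⊆ D') :
    LocalOn Q' D' f :=
  fun x hx y hy hxy => h x (hQ hx) y (hQ hy) fun i hi => hxy i (hD hi)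

theorem NarrowOn.mono {n m K : ℕ} {Q Q' : Set (Fin n → Bool)}
    {s : Fin (m + 1) → (Fin n → Bool) → ℝ} (h : NarrowOn Q K s) (hQ : Q' ⊆ Q) :
    NarrowOn Q' K s := by
  obtain ⟨J, hJ, hs⟩ := h
  exact ⟨J, hJ, fun x hx => hs x (hQ hx)⟩

theorem le_firstArgmax {n : ℕ} (a : Fin (n + 1) → ℝ) (j : Fin (n + 1)) :
    a j ≤ a (firstArgmax a) := by
  exact (Set.Finite.mem_toFinset _).1 (Finset.min'_mem _ (argmaxSet_nonempty a)) j

theorem firstArgmax_le {n : ℕ} (a : Fin (n + 1) → ℝ) {i : Fin (n + 1)} (hi : ∀ j, a j ≤ a i) :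
    firstArgmax a ≤ i :=
  Finset.min'_le _ _ (by simpa using hi)

/-- Both chosen positions have the same score in either family, so the two maxima coincide and each
position is a maximizer of both families. -/
theorem firstArgmax_congr {n : ℕ} {a b : Fin (n + 1) → ℝ} {J : Finset (Fin (n + 1))}
    (ha : firstArgmax a ∈ J) (hb : firstArgmax b ∈ J) (hab : ∀ j ∈ J, a j = b j) :
    firstArgmax a = firstArgmax b := by
  have h1 := le_firstArgmax a (firstArgmax b)
  have h2 := le_firstArgmax b (firstArgmax a)
  rw [← hab _ ha, ← hab _ hb] at h2
  refine le_antisymm (firstArgmax_le a fun j => ?_) (firstArgmax_le b fun j => ?_)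
  · exact (le_firstArgmax a j).trans h2
  · rw [← hab _ ha]
    refine (le_firstArgmax b j).trans ?_
    rwa [← hab _ hb]

/-- A finite type has an initial segment of every possible size, in the preorder given by a
key in a linear order. -/
theorem exists_initial_segment {ι κ : Type*} [Fintype ι] [DecidableEq ι] [LinearOrder κ]
    (key : ι → κ) (K : ℕ) (hK : K ≤ Fintype.card ι) :
    ∃ T : Finset ι, T.card = K ∧ ∀ j ∈ T, ∀ j' ∉ T, key j ≤ key j' := by
  induction K with
  | zero => exact ⟨∅, by simp⟩
  | succ K ih =>
    obtain ⟨T, hT, hkey⟩ := ih (by omega)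
    have hne : (Tᶜ : Finset ι).Nonempty := by
      rw [← Finset.card_pos, Finset.card_compl]
      omega
    obtain ⟨i, hi, hmin⟩ := Finset.exists_min_image _ key hne
    rw [Finset.mem_compl] at hi
    refine ⟨insert i T, by rw [Finset.card_insert_of_notMem hi, hT], fun j hj j' hj' => ?_⟩
    rw [Finset.mem_insert, not_or] at hj'
    rcases Finset.mem_insert.1 hj with rfl | hj
    · exact hmin j' (by simpa using hj'.2)
    · exact hkey j hj j' hj'.2

/-- There are `K` nodes such that fixing the bits of any one of them suitably confines the first
maximizer to these nodes. -/
theorem exists_narrowing_nodes {n m K : ℕ} (Q : Subcube n)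
    {s : Fin (m + 1) → (Fin n → Bool) → ℝ} {D : Fin (m + 1) → Finset (Fin n)}
    (hs : ∀ j, LocalOn Q.points (D j) (s j)) (hK : K ≤ m + 1) :
    ∃ T : Finset (Fin (m + 1)), T.card = K ∧ ∀ j ∈ T, ∃ A ∈ (D j).powerset,
      (Q.fix (D j) A).points ⊆ Q.points ∧ NarrowOn (Q.fix (D j) A).points K s := by
  have hmax : ∀ j, ∃ b ∈ Q.points, ∀ x ∈ Q.points, s j x ≤ s j b := fun j =>
    Set.exists_max_image _ (s j) (Set.toFinite _) ⟨_, Q.val_mem_points⟩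
  choose b hb hbmax using hmax
  -- Decreasing attainable maximum, ties by position, to match the choice of the first maximizer.
  obtain ⟨T, hT, hkey⟩ := exists_initial_segment
    (fun j : Fin (m + 1) => toLex (-(s j (b j)), j)) K (by simpa using hK)
  refine ⟨T, hT, fun j hj => ⟨(D j).filter fun i => b j i = true, by simp,
    Q.fix_points_subset _ (hb j), T, hT.le, fun x hx => ?_⟩⟩
  have hxQ := Q.fix_points_subset _ (hb j) hx
  -- The score of `j` is now frozen at its maximum: a node outside `T` can win neither by a higher
  -- score nor, on a tie, by an earlier position.
  have hsx : s j x = s j (b j) := hs j x hxQ _ (hb j) fun i hi => by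
    rw [hx i (Finset.mem_union_right _ hi)]
    exact Subcube.patch_filter_of_mem hi _ _
  by_contra hnot
  have hle := hkey j hj _ hnot
  set j' := firstArgmax fun j => s j x with hj'
  have h1 : s j x ≤ s j' x := le_firstArgmax (fun j => s j x) j
  have h2 := hbmax j' x hxQ
  rw [Prod.Lex.toLex_le_toLex] at hle
  rcases hle with hlt | ⟨heq, hle⟩
  · simp only at hlt
    linarith
  · simp only at heq hle
    have h3 : j' ≤ j := firstArgmax_le (fun j => s j x) fun k =>
      (le_firstArgmax (fun j => s j x) k).trans (by
        change s j' x ≤ s j x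
        linarith)
    exact hnot (le_antisymm h3 hle ▸ hj)

/-! ### Greedy narrowing. -/

/-- Repeat a step that lowers the potential `U` by at least `R` at cost at most `c` until the
potential is at most `θ`. -/
theorem exists_low_potential {σ : Type*} (rel : σ → σ → Prop) (hrefl : ∀ s, rel s s)
    (htrans : ∀ s t u, rel s t → rel t u → rel s u) (cost U : σ → ℕ) {R c θ : ℕ} (hR : 0 < R)
    (s₀ : σ) (hstep : ∀ s, rel s₀ s → θ < U s →
      ∃ t, rel s t ∧ cost t ≤ cost s + c ∧ U t + R ≤ U s) :
    ∃ t, rel s₀ t ∧ U t ≤ θ ∧ R * cost t + c * U t ≤ R * cost s₀ + c * U s₀ := by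
  -- The quantity `R * cost + c * U` never increases along the steps.
  have main : ∀ N s, U s = N → rel s₀ s →
      ∃ t, rel s t ∧ U t ≤ θ ∧ R * cost t + c * U t ≤ R * cost s + c * U s := by
    intro N
    induction N using Nat.strong_induction_on with
    | _ N ih =>
      intro s hs hrel
      by_cases hθ : U s ≤ θ
      · exact ⟨s, hrefl s, hθ, le_rfl⟩
      obtain ⟨t, hst, hcost, hU⟩ := hstep s hrel (by omega)
      obtain ⟨u, htu, huθ, hu⟩ := ih (U t) (by omega) t rfl (htrans _ _ _ hrel hst)
      refine ⟨u, htrans _ _ _ hst htu, huθ, hu.trans ?_⟩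
      calc R * cost t + c * U t ≤ R * (cost s + c) + c * U t := by gcongr
        _ = R * cost s + c * (U t + R) := by ring
        _ ≤ R * cost s + c * U s := by gcongr
  exact main _ s₀ rfl (hrefl s₀)

section Demands

open scoped Classical in
/-- The score families whose first maximizer is not confined to `K` values on `Q`. -/
noncomputable def wide {n m : ℕ} {τ : Type*} [Fintype τ]
    (s : τ → Fin (m + 1) → (Fin n → Bool) → ℝ) (K : ℕ) (Q : Subcube n) : Finset τ :=
  Finset.univ.filter fun t => ¬ NarrowOn Q.points K (s t)

variable {n m : ℕ} {τ : Type*} [Fintype τ] {s : τ → Fin (m + 1) → (Fin n → Bool) → ℝ}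
  {D : Fin (m + 1) → Finset (Fin n)} {c K : ℕ}

/-- Fixing the bits of one well-chosen node makes many of the wide score families narrow. -/
theorem exists_narrowing_step (Q : Subcube n)
    (hs : ∀ t j, LocalOn Q.points (D j) (s t j)) (hD : ∀ j, (D j).card ≤ c)
    (hne : (wide s K Q).Nonempty) :
    ∃ Q' : Subcube n, Q'.points ⊆ Q.points ∧ Q'.fixed.card ≤ Q.fixed.card + c ∧
      (wide s K Q').card ≤ (wide s K Q).card ∧
      (wide s K Q).card * K ≤
        ((wide s K Q).card - (wide s K Q').card) * ((m + 1) * 2 ^ c) := by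
  classical
  have hK : K ≤ m + 1 := by
    obtain ⟨t, ht⟩ := hne
    by_contra hlt
    refine (Finset.mem_filter.1 ht).2 ⟨Finset.univ, ?_, by simp⟩
    simp only [Finset.card_univ, Fintype.card_fin]
    omega
  set pairs : Finset (Σ _ : Fin (m + 1), Finset (Fin n)) :=
    Finset.univ.sigma fun j => (D j).powerset with hpairs
  have hcard : pairs.card ≤ (m + 1) * 2 ^ c := by
    rw [hpairs, Finset.card_sigma]
    calc ∑ j, (D j).powerset.card ≤ ∑ _j : Fin (m + 1), 2 ^ c :=
          Finset.sum_le_sum fun j _ => by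
            rw [Finset.card_powerset]
            exact Nat.pow_le_pow_right two_pos (hD j)
      _ = (m + 1) * 2 ^ c := by simp
  -- Containment is part of the relation because an arbitrary setting may contradict bits fixed by
  -- `Q`.
  let r : τ → (Σ _ : Fin (m + 1), Finset (Fin n)) → Prop := fun t p =>
    (Q.fix (D p.1) p.2).points ⊆ Q.points ∧ NarrowOn (Q.fix (D p.1) p.2).points K (s t)
  have habove : ∀ t, K ≤ (pairs.bipartiteAbove r t).card := by
    intro t
    obtain ⟨T, hT, hTA⟩ := exists_narrowing_nodes Q (hs t) hK
    choose! A hA hAsub hAnarrow using hTA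
    refine hT.symm.le.trans ?_
    refine Finset.card_le_card_of_injOn (fun j => ⟨j, A j⟩) (fun j hj => ?_) ?_
    · rw [Finset.mem_coe, Finset.mem_bipartiteAbove]
      exact ⟨by simpa [hpairs] using hA j hj, hAsub j hj, hAnarrow j hj⟩
    · intro j _ j' _ h
      exact congrArg Sigma.fst h
  have hcount : (wide s K Q).card * K ≤
      ∑ p ∈ pairs, ((wide s K Q).bipartiteBelow r p).card := by
    rw [← Finset.sum_card_bipartiteAbove_eq_sum_card_bipartiteBelow]
    calc (wide s K Q).card * K = ∑ _t ∈ wide s K Q, K := by simp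
      _ ≤ _ := Finset.sum_le_sum fun t _ => habove t
  have hpne : pairs.Nonempty := ⟨⟨0, ∅⟩, by simp [hpairs]⟩
  obtain ⟨p₀, _, hp₀max⟩ := Finset.exists_max_image pairs
    (fun p => ((wide s K Q).bipartiteBelow r p).card) hpne
  have hbound : (wide s K Q).card * K ≤
      ((wide s K Q).bipartiteBelow r p₀).card * ((m + 1) * 2 ^ c) := by
    refine hcount.trans ((Finset.sum_le_card_nsmul _ _ _ hp₀max).trans ?_)
    rw [smul_eq_mul, mul_comm]
    gcongr
  -- Containment in `Q` is known only through a related family; without one, the bound has right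
  -- side 0 and `Q` itself serves.
  rcases ((wide s K Q).bipartiteBelow r p₀).eq_empty_or_nonempty with hemp | ⟨t, ht⟩
  · refine ⟨Q, subset_rfl, by omega, le_rfl, ?_⟩
    simpa [hemp] using hbound
  rw [Finset.mem_bipartiteBelow] at ht
  have hsub := ht.2.1
  have hdisj : wide s K (Q.fix (D p₀.1) p₀.2) ⊆
      wide s K Q \ (wide s K Q).bipartiteBelow r p₀ := by
    intro u hu
    have hu' := (Finset.mem_filter.1 hu).2
    rw [Finset.mem_sdiff, Finset.mem_bipartiteBelow]
    exact ⟨Finset.mem_filter.2 ⟨Finset.mem_univ _, fun h => hu' (h.mono hsub)⟩,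
      fun h => hu' h.2.2⟩
  have hle := Finset.card_le_card hdisj
  have hb : ((wide s K Q).bipartiteBelow r p₀).card ≤ (wide s K Q).card :=
    Finset.card_le_card (Finset.filter_subset _ _)
  rw [Finset.card_sdiff_of_subset
    (show (wide s K Q).bipartiteBelow r p₀ ⊆ _ from Finset.filter_subset _ _)] at hle
  refine ⟨_, hsub, (Q.card_fix_le _ _).trans (Nat.add_le_add_left (hD _) _), by omega,
    hbound.trans ?_⟩
  gcongr
  omega

/-- All score families can be made narrow at once, at a cost controlled by the rate `R`. -/
theorem exists_narrow_subcube (Q : Subcube n)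
    (hs : ∀ t j, LocalOn Q.points (D j) (s t j)) (hD : ∀ j, (D j).card ≤ c)
    {R : ℕ} (hR : 0 < R) (hK : 0 < K) :
    ∃ Q' : Subcube n, Q'.points ⊆ Q.points ∧ (∀ t, NarrowOn Q'.points K (s t)) ∧
      R * K * Q'.fixed.card ≤ R * K * Q.fixed.card + c * K * Fintype.card τ +
        c * R * (R * ((m + 1) * 2 ^ c)) := by
  classical
  set M := (m + 1) * 2 ^ c with hM
  have hrefl : ∀ Q : Subcube n, Q.points ⊆ Q.points := fun _ => subset_rfl
  have htrans : ∀ Q Q' Q'' : Subcube n, Q'.points ⊆ Q.points → Q''.points ⊆ Q'.points →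
      Q''.points ⊆ Q.points := fun _ _ _ h h' => h'.trans h
  -- Bulk phase: above the threshold `R * M / K`, the average guarantees at least `R` newly narrow
  -- families per step.
  obtain ⟨Q₁, hQ₁, hU₁, hcost₁⟩ := exists_low_potential
    (fun Q Q' : Subcube n => Q'.points ⊆ Q.points) hrefl htrans (fun Q => Q.fixed.card)
    (fun Q => (wide s K Q).card) (R := R) (c := c) (θ := R * M / K) hR Q (by
      intro Q' hQ' hθ
      obtain ⟨Q'', hsub, hcost, hle, hU⟩ := exists_narrowing_step Q'
        (fun t j => (hs t j).mono hQ' subset_rfl) hD (Finset.card_pos.1 (Nat.zero_lt_of_lt hθ))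
      refine ⟨Q'', hsub, hcost, ?_⟩
      rw [Nat.div_lt_iff_lt_mul hK] at hθ
      have : R < (wide s K Q').card - (wide s K Q'').card :=
        lt_of_mul_lt_mul_right (hθ.trans_le hU) (Nat.zero_le M)
      omega)
  -- Clean-up phase: the few remaining families are removed at cost at most `c` each.
  obtain ⟨Q₂, hQ₂, hU₂, hcost₂⟩ := exists_low_potential
    (fun Q Q' : Subcube n => Q'.points ⊆ Q.points) hrefl htrans (fun Q => Q.fixed.card)
    (fun Q => (wide s K Q).card) (R := 1) (c := c) (θ := 0) one_pos Q₁ (by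
      intro Q' hQ' hθ
      obtain ⟨Q'', hsub, hcost, hle, hU⟩ := exists_narrowing_step Q'
        (fun t j => (hs t j).mono (hQ'.trans hQ₁) subset_rfl) hD (Finset.card_pos.1 hθ)
      refine ⟨Q'', hsub, hcost, ?_⟩
      have : 0 < (wide s K Q').card - (wide s K Q'').card :=
        Nat.pos_of_mul_pos_right (lt_of_lt_of_le (Nat.mul_pos hθ hK) hU)
      omega)
  refine ⟨Q₂, hQ₂.trans hQ₁, fun t => ?_, ?_⟩
  · by_contra h
    have hmem : t ∈ wide s K Q₂ := Finset.mem_filter.2 ⟨Finset.mem_univ _, h⟩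
    have := Finset.card_pos.2 ⟨t, hmem⟩
    omega
  · have hUK : K * (wide s K Q₁).card ≤ R * M := by
      rw [mul_comm]
      exact (Nat.le_div_iff_mul_le hK).1 hU₁
    have hU₀ : (wide s K Q).card ≤ Fintype.card τ := Finset.card_le_univ _
    have e₂ : Q₂.fixed.card ≤ Q₁.fixed.card + c * (wide s K Q₁).card := by
      have := Nat.zero_le (c * (wide s K Q₂).card)
      omega
    have e₁ : R * Q₁.fixed.card ≤ R * Q.fixed.card + c * (wide s K Q).card := by
      have := Nat.zero_le (c * (wide s K Q₁).card)
      omega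
    calc R * K * Q₂.fixed.card
        ≤ R * K * (Q₁.fixed.card + c * (wide s K Q₁).card) := by gcongr
      _ = K * (R * Q₁.fixed.card) + c * R * (K * (wide s K Q₁).card) := by ring
      _ ≤ K * (R * Q.fixed.card + c * Fintype.card τ) + c * R * (R * M) := by
          gcongr
          exact e₁.trans (by gcongr)
      _ = _ := by ring

end Demands

/-! ### Locality through the layers. -/

/-- One layer of hard attention keeps activations local, at the price of fixing a small fraction
of the bits. -/
theorem exists_subcube_local_layer (c H : ℕ) {ε : ℝ} (hε : 0 < ε) :
    ∃ c' : ℕ, ∀ {n m : ℕ} {A B : Type*} (att : Fin H → A → A → ℝ) (act : A → (Fin H → A) → B)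
      (u : (Fin n → Bool) → Fin (m + 1) → A) (Q : Subcube n),
      (∀ i, ∃ D : Finset (Fin n), D.card ≤ c ∧ LocalOn Q.points D fun x => u x i) →
      ∃ Q' : Subcube n, (Q'.fixed.card : ℝ) ≤ Q.fixed.card + ε * (m + 1) ∧
        ∀ i, ∃ D : Finset (Fin n), D.card ≤ c' ∧ LocalOn Q'.points D fun x =>
          act (u x i) fun h =>
            HardTransformer.headActivation (fun j => att h (u x i) (u x j)) (u x) := by
  classical
  -- `R` makes the bulk phase cost at most `ε * (m + 1) / 2`; `K`, chosen after `R`, does the same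
  -- for the clean-up.
  obtain ⟨R, hR⟩ := exists_nat_gt (2 * (c * 2 ^ c * H : ℝ) / ε)
  have hRpos : 0 < R := by
    have : (0 : ℝ) < R := lt_of_le_of_lt (by positivity) hR
    exact_mod_cast this
  obtain ⟨K, hK⟩ := exists_nat_gt (2 * (c * R * 2 ^ c : ℝ) / ε)
  have hKpos : 0 < K := by
    have : (0 : ℝ) < K := lt_of_le_of_lt (by positivity) hK
    exact_mod_cast this
  rw [div_lt_iff₀ hε] at hR hK
  refine ⟨c + 2 ^ c * (H * (K * c)), fun {n m A B} att act u Q hu => ?_⟩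
  choose D hDc hDloc using hu
  let b : (i : Fin (m + 1)) → Finset (Fin n) → (Fin n → Bool) :=
    fun i S => Subcube.patch (D i) S Q.val
  let τ := Σ i : Fin (m + 1), (D i).powerset × Fin H
  have hτ : Fintype.card τ ≤ (m + 1) * (2 ^ c * H) := by
    have : Fintype.card τ = ∑ i, 2 ^ (D i).card * H := by
      simp only [τ, Fintype.card_sigma, Fintype.card_prod, Fintype.card_coe, Finset.card_powerset,
        Fintype.card_fin]
    rw [this]
    calc ∑ i, 2 ^ (D i).card * H ≤ ∑ _i : Fin (m + 1), 2 ^ c * H :=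
          Finset.sum_le_sum fun i _ =>
            Nat.mul_le_mul_right _ (Nat.pow_le_pow_right two_pos (hDc i))
      _ = _ := by simp
  -- The querying activation is frozen, one family per setting of `D i`, so the score of `j` depends
  -- on `D j` alone. Settings incompatible with `Q` only add harmless families.
  let s : τ → Fin (m + 1) → (Fin n → Bool) → ℝ :=
    fun t j x => att t.2.2 (u (b t.1 t.2.1) t.1) (u x j)
  obtain ⟨Q', hsub, hnarrow, hcost⟩ := exists_narrow_subcube (s := s) Q
    (fun t j x hx y hy hxy => by
      have := hDloc j x hx y hy hxy
      simp only at this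
      simp only [s, this]) hDc hRpos hKpos
  refine ⟨Q', ?_, fun i => ?_⟩
  · have h1 : (R * K * Q'.fixed.card : ℝ) ≤ R * K * Q.fixed.card +
        c * K * ((m + 1) * (2 ^ c * H)) + c * R * (R * ((m + 1) * 2 ^ c)) := by
      exact_mod_cast hcost.trans (by gcongr)
    have h2 : (K * (m + 1) : ℝ) * (2 * (c * 2 ^ c * H)) ≤ (K * (m + 1)) * (R * ε) := by gcongr
    have h3 : (R * (m + 1) : ℝ) * (2 * (c * R * 2 ^ c)) ≤ (R * (m + 1)) * (K * ε) := by gcongr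
    have hRK : (0 : ℝ) < R * K := by positivity
    refine le_of_mul_le_mul_left ?_ hRK
    linarith
  · choose J hJc hJ using hnarrow
    let W : Finset ((D i).powerset × Fin H) := Finset.univ
    -- The bits in `D i` select the family; those of its candidates decide the winner and its
    -- activation.
    refine ⟨D i ∪ W.biUnion fun p => (J ⟨i, p⟩).biUnion D, ?_, ?_⟩
    · refine (Finset.card_union_le _ _).trans (Nat.add_le_add (hDc i) ?_)
      refine (Finset.card_biUnion_le_card_mul _ _ (K * c) fun p _ => ?_).trans ?_
      · exact (Finset.card_biUnion_le_card_mul _ _ c fun j _ => hDc j).trans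
          (Nat.mul_le_mul_right _ (hJc _))
      · have : W.card = 2 ^ (D i).card * H := by
          simp only [W, Finset.card_univ, Fintype.card_prod, Fintype.card_coe,
            Finset.card_powerset, Fintype.card_fin]
        rw [this, mul_assoc]
        exact Nat.mul_le_mul_right _ (Nat.pow_le_pow_right two_pos (hDc i))
    · intro x hx y hy hxy
      have hxi : u x i = u y i := hDloc i x (hsub hx) y (hsub hy) fun k hk =>
        hxy k (Finset.mem_union_left _ hk)
      simp only
      rw [← hxi]
      congr 1
      funext h
      let S : (D i).powerset := ⟨(D i).filter fun k => x k = true, by simp⟩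
      have hbx : u (b i S) i = u x i :=
        hDloc i _ (Q.patch_filter_mem_points _ (hsub hx)) x (hsub hx) fun k hk =>
          Subcube.patch_filter_of_mem hk _ _
      have hJx := hJ ⟨i, S, h⟩
      simp only [s, hbx] at hJx
      have hloc : ∀ j ∈ J ⟨i, S, h⟩, u x j = u y j := fun j hj =>
        hDloc j x (hsub hx) y (hsub hy) fun k hk => hxy k <| Finset.mem_union_right _ <|
          Finset.mem_biUnion.2 ⟨(S, h), Finset.mem_univ _, Finset.mem_biUnion.2 ⟨j, hj, hk⟩⟩
      have heq := firstArgmax_congr (hJx x hx) (hJx y hy) fun j hj => by rw [hloc j hj]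
      unfold HardTransformer.headActivation
      rw [← heq]
      exact hloc _ (hJx x hx)

/-- After fixing a small fraction of the bits, every activation of layer `k` depends on a bounded
number of bits. -/
theorem exists_subcube_local_activation {V : Type*} {E : Type*} {P : Type*} {Y : ℕ → Type*}
    {O : Type*} {L H : ℕ} (T : HardTransformer V E P Y O L H) (bit : Bool → V) (eos : V)
    {ε : ℝ} (hε : 0 < ε) (k : ℕ) :
    ∃ c : ℕ, ∀ n : ℕ, ∃ Q : Subcube n, (Q.fixed.card : ℝ) ≤ k * (ε * (n + 1)) ∧
      ∀ i, ∃ D : Finset (Fin n), D.card ≤ c ∧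
        LocalOn Q.points D fun x => T.activation (inputWord bit eos x) k i := by
  induction k with
  | zero =>
    refine ⟨1, fun n => ⟨⟨∅, fun _ => false⟩, by simp, fun i => ?_⟩⟩
    induction i using Fin.lastCases with
    | last =>
      refine ⟨∅, by simp, fun x _ y _ _ => ?_⟩
      simp [HardTransformer.activation, inputWord]
    | cast i =>
      refine ⟨{i}, by simp, fun x _ y _ hxy => ?_⟩
      simp [HardTransformer.activation, inputWord, hxy i (by simp)]
  | succ k ih =>
    obtain ⟨c, hc⟩ := ih
    obtain ⟨c', hc'⟩ := exists_subcube_local_layer c H hε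
    refine ⟨c', fun n => ?_⟩
    obtain ⟨Q, hQ, hloc⟩ := hc n
    obtain ⟨Q', hQ', hloc'⟩ := hc' (T.att k) (T.act k)
      (fun x i => T.activation (inputWord bit eos x) k i) Q hloc
    refine ⟨Q', ?_, hloc'⟩
    push_cast
    linarith

theorem theorem1 {V : Type*} {E : Type*} {P : Type*} {Y : ℕ → Type*} {O : Type*} {L H : ℕ}
    (T : HardTransformer V E P Y O L H) (bit : Bool → V) (eos : V)
    (C : ℝ) (hC0 : 0 < C) (hC1 : C < 1) :
    ∃ (ρ : InputRestriction) (c : ℕ), 0 < c ∧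
      (∀ᶠ n : ℕ in atTop, C * (n : ℝ) ≤ ((ρ.free n).card : ℝ)) ∧
      ∀ n : ℕ, ∃ S : Finset (Fin n), S.card ≤ c ∧
        DependsOn (fun x : Fin n → Bool => T.output (inputWord bit eos (ρ.apply x)))
          (S : Set (Fin n)) := by
  -- `L` layers lose at most `(1 - C) * (n + 1) / 2` bits, which is at most `(1 - C) * n` once `n ≥
  -- 1`; `L + 1` also covers `L = 0`.
  have hε : 0 < (1 - C) / (2 * (L + 1)) := div_pos (by linarith) (by positivity)
  obtain ⟨c, hc⟩ := exists_subcube_local_activation T bit eos hε L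
  choose Q hQ hloc using hc
  refine ⟨fun n => (Q n).restriction, c + 1, by omega, ?_, fun n => ?_⟩
  · filter_upwards [eventually_ge_atTop 1] with n hn
    have hn' : (1 : ℝ) ≤ n := by exact_mod_cast hn
    have hfree : InputRestriction.free (fun n => (Q n).restriction) n = (Q n).fixedᶜ := by
      ext i
      simp [InputRestriction.free, Subcube.restriction]
    have hcard : ((Q n).fixedᶜ.card : ℝ) = n - (Q n).fixed.card := by
      rw [Finset.card_compl, Fintype.card_fin,
        Nat.cast_sub (by simpa using Finset.card_le_univ (Q n).fixed)]
    have hlost : (L : ℝ) * ((1 - C) / (2 * (L + 1)) * (n + 1)) ≤ (1 - C) * n := by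
      have hfrac : (L : ℝ) * ((1 - C) / (2 * (L + 1)) * (n + 1)) =
          (1 - C) * ((n + 1) / 2) * (L / (L + 1)) := by
        field_simp
      have hL : (L : ℝ) / (L + 1) ≤ 1 := (div_le_one (by positivity)).2 (by linarith)
      have hpos : 0 ≤ (1 - C) * (((n : ℝ) + 1) / 2) :=
        mul_nonneg (by linarith) (by positivity)
      rw [hfrac]
      refine (mul_le_of_le_one_right hpos hL).trans ?_
      exact mul_le_mul_of_nonneg_left (by linarith) (by linarith)
    rw [hfree, hcard]
    linarith [hQ n]
  · obtain ⟨D, hD, hDloc⟩ := hloc n (Fin.last n)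
    have hmem : ∀ x, InputRestriction.apply (fun n => (Q n).restriction) x ∈ (Q n).points := by
      intro x i hi
      simp [InputRestriction.apply, Subcube.restriction, hi]
    refine ⟨D, by omega, fun x y hxy => ?_⟩
    refine congrArg T.readout (hDloc _ (hmem x) _ (hmem y) fun i hi => ?_)
    simp only [InputRestriction.apply]
    rw [hxy i hi]
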